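/- For a finite group $G$ and integers $x_g$ ($g\in G$), the integer group determinant $\mathscr{D}_G$ is the determinant of the $|G|\times|G|$ matrix, with rows and columns indexed by $G$, whose $(g,h)$ entry is $x_{gh^{-1}}$. Let $\lambda(G)$ be the smallest value $|\mathscr{D}_G|\ge 2$ attained as the $x_g$ range over all integers. Let $Q_{4n}=\langle x,y : x^{2n}=1,\ y^2=x^n,\ xy=yx^{-1}\rangle$ be the dicyclic group of order $4n$. **Theorem.** If $n\ge 1$ is odd, then $$\lambda(Q_{4n})=\min\{16,p_0\},$$ where $p_0$ is the smallest prime not dividing $2n$. That is, $$\lambda(Q_{4n})=\begin{cases}3 & \text{if } 3\nmid n,\\ 5 & \text{if } 3\mid n,\ 5\nmid n,\\ 7 & \text{if } 3\cdot5\mid n,\ 7\nmid n,\\ 11 & \text{if } 3\cdot5\cdot7\mid n,\ 11\nmid n,\\ 13 & \text{if } 3\cdot5\cdot7\cdot11\mid n,\ 13\nmid n,\\ 16 & \text{if } 3\cdot5\cdot7\cdot11\cdot13\mid n.\end{cases}$$ -/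

import Mathlib

/-- The group determinant of a finite group `G`: the determinant of the matrix, with rows and columns
indexed by `G`, whose `(g, h)` entry is `x (g * h⁻¹)`. -/
def groupDeterminant {G : Type*} [Group G] [Fintype G] [DecidableEq G] {R : Type*} [CommRing R]
    (x : G → R) : R :=
  Matrix.det (Matrix.of fun g h : G => x (g * h⁻¹))

/-- The set `S(G)` of all integer group determinants of `G`. -/
def integerGroupDeterminants (G : Type*) [Group G] [Fintype G] [DecidableEq G] : Set ℤ :=
  Set.range fun x : G → ℤ => groupDeterminant x

/-- The absolute values of the integer group determinants of `G` that are at least `2`. -/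
def nontrivialAbsDeterminants (G : Type*) [Group G] [Fintype G] [DecidableEq G] : Set ℕ :=
  {m | 2 ≤ m ∧ ∃ d ∈ integerGroupDeterminants G, d.natAbs = m}

/-- `λ(G)`: the smallest absolute value, among those at least `2`, of an integer group
determinant of `G`. -/
noncomputable def minimalDeterminant (G : Type*) [Group G] [Fintype G] [DecidableEq G] : ℕ :=
  sInf (nontrivialAbsDeterminants G)

/-!
Let `n` be odd and let `x` be an integer-valued function on the dicyclic group, with `f` and `g` its
restrictions to `⟨a 1⟩` and to the other coset. The Fourier transform on `⟨a 1⟩` splits the group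
determinant into the `2 × 2` determinants
`A j = f̂ j * f̂ (-j) - ψ (j * n) * ĝ j * ĝ (-j)`, `j : ZMod (2 * n)` (`groupDeterminant_eq_prod`).

Lower bound. The product of the `A j` over a set of indices stable under multiplication by units is
a rational integer, by Galois descent. Since `A (-j) = A j`, it is even the square of a rational
integer if no index in the set is its own negative (`exists_int_sq_eq_prod`). Modulo a prime `P`
above `p`, the Frobenius gives `A j ^ p = A (p * j)`, so membership in `P` is the same for all
indices with the same `p`-multiple. If an odd prime `p ∣ n` divides the determinant, it therefore
divides both the contribution of the characters of order prime to `p` and the square contributed by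
the others, which gives `p ^ 3` (`prime_pow_three_dvd_groupDeterminant`). If `2` divides it, either
two different squares are even or the contribution of the four linear characters is even, and in both cases `16` divides the
determinant (`sixteen_dvd_groupDeterminant`). So a determinant between `2` and `15` in absolute
value is prime to `2 * n`, hence at least the smallest prime not dividing `2 * n`.

Attained values. Let `t` generate the subgroup of order `n` and let `ε` be the central involution.
For `U` and `h` in `ℤ[t]` with `U` symmetric, the element with `f = U + (1 + ε) h` and
`g = (1 + ε) h` has determinant `N (U + 2 (h + h̄)) * N U ^ 3`, where `N` is the norm of `ℤ[t]`
(`exists_groupDeterminant_eq`). For `p` prime to `2 * n` there is a `U` of norm `1` for which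
`U + 2 (h + h̄)` can be made plus or minus the symmetric geometric sum of length `p`, whose norm is
`p` (`exists_natAbs_groupDeterminant_eq`). The element `1 + t` has determinant `16`.
-/

/-! ### Factorization of the determinant over the characters of the cyclic subgroup -/

/-- The Fourier coefficient `∑ i, f i * ψ (j * i)` of an integer-valued function on `ZMod N`, that
is, the value of the element `f` of the group ring at the character `i ↦ ψ (j * i)`. -/
def charSum {N : ℕ} [NeZero N] {R : Type*} [CommRing R] (ψ : AddChar (ZMod N) R) (f : ZMod N → ℤ)
    (j : ZMod N) : R :=
  ∑ i, (f i : R) * ψ (j * i)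

/-- The determinant of the two-dimensional representation of `QuaternionGroup n` induced from the
character `i ↦ ψ (j * i)` of `⟨a 1⟩`, at the group ring element `x`. -/
def quaternionFactor {n : ℕ} [NeZero n] {R : Type*} [CommRing R] (ψ : AddChar (ZMod (2 * n)) R)
    (x : QuaternionGroup n → ℤ) (j : ZMod (2 * n)) : R :=
  charSum ψ (fun i => x (.a i)) j * charSum ψ (fun i => x (.a i)) (-j) -
    ψ (j * n) * charSum ψ (fun i => x (.xa i)) j * charSum ψ (fun i => x (.xa i)) (-j)

/-- The elements of `QuaternionGroup n` as two copies of `ZMod (2 * n)`. -/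
def quaternionEquiv (n : ℕ) : Fin 2 × ZMod (2 * n) ≃ QuaternionGroup n where
  toFun p := if p.1 = 0 then .a p.2 else .xa p.2
  invFun
    | .a i => (0, i)
    | .xa i => (1, i)
  left_inv := by
    rintro ⟨b, i⟩
    fin_cases b <;> simp
  right_inv := by rintro (i | i) <;> simp

/-- The Fourier matrix with entries `ψ (j * i)` is invertible up to the factor `N`. -/
theorem det_fourier_ne_zero {N : ℕ} [NeZero N] {R : Type*} [CommRing R] [IsDomain R] [CharZero R]
    {ψ : AddChar (ZMod N) R} (hψ : ψ.IsPrimitive) :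
    (Matrix.of fun i j : ZMod N => ψ (j * i)).det ≠ 0 := by
  have h : (Matrix.of fun i j : ZMod N => ψ (j * i)) * (Matrix.of fun i j : ZMod N => ψ (-(j * i)))
      = (N : R) • (1 : Matrix (ZMod N) (ZMod N) R) := by
    ext i k
    have := AddChar.sum_mulShift (i - k) hψ
    simp only [ZMod.card] at this
    simp only [Matrix.mul_apply, Matrix.of_apply, ← AddChar.map_add_eq_mul, Matrix.smul_apply,
      Matrix.one_apply, smul_eq_mul, mul_ite, mul_one, mul_zero]
    calc _ = ∑ x : ZMod N, ψ (x * (i - k)) := Finset.sum_congr rfl fun x _ => by congr 1; ring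
      _ = _ := by rw [this]; simp [sub_eq_zero]
  intro h0
  have h1 := congrArg Matrix.det h
  rw [Matrix.det_mul, h0, zero_mul, Matrix.det_smul, Matrix.det_one, mul_one] at h1
  exact pow_ne_zero _ (NeZero.ne (N : R)) h1.symm

theorem det_kronecker_fourier_ne_zero {N : ℕ} [NeZero N] {R : Type*} [CommRing R] [IsDomain R]
    [CharZero R] {ψ : AddChar (ZMod N) R} (hψ : ψ.IsPrimitive) :
    (Matrix.kroneckerMap (· * ·) (1 : Matrix (Fin 2) (Fin 2) R)
      (Matrix.of fun i j : ZMod N => ψ (j * i))).det ≠ 0 := by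
  rw [Matrix.det_kronecker]
  simpa using det_fourier_ne_zero hψ

section
variable {N : ℕ} [NeZero N] {R : Type*} [CommRing R] (ψ : AddChar (ZMod N) R)

theorem char_mul_eq_pow (a i : ZMod N) : ψ (a * i) = ψ a ^ i.val := by
  rw [← AddChar.map_nsmul_eq_pow, nsmul_eq_mul, ZMod.natCast_zmod_val, mul_comm i]

theorem char_eq_one_iff {ψ : AddChar (ZMod N) R} (hψ : ψ.IsPrimitive) {a : ZMod N} :
    ψ a = 1 ↔ a = 0 := by
  refine ⟨fun h => by_contra fun ha => hψ ha ?_, fun h => by rw [h, AddChar.map_zero_eq_one]⟩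
  ext i
  rw [AddChar.mulShift_apply, char_mul_eq_pow, h, one_pow, AddChar.one_apply]

theorem sum_sub_mul_char (f : ZMod N → ℤ) (i j : ZMod N) :
    ∑ k, (f (i - k) : R) * ψ (j * k) = ψ (j * i) * charSum ψ f (-j) := by
  rw [charSum, Finset.mul_sum, ← Equiv.sum_comp (Equiv.subLeft i)]
  refine Finset.sum_congr rfl fun k _ => ?_
  have : ψ (j * (i - k)) = ψ (j * i) * ψ (-j * k) := by
    rw [← AddChar.map_add_eq_mul]; congr 1; ring
  simp only [Equiv.subLeft_apply, sub_sub_cancel, this]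
  ring

theorem sum_add_sub_mul_char (f : ZMod N → ℤ) (c i j : ZMod N) :
    ∑ k, (f (c + k - i) : R) * ψ (j * k) = ψ (j * i) * (ψ (-(j * c)) * charSum ψ f j) := by
  rw [charSum, Finset.mul_sum, Finset.mul_sum, ← Equiv.sum_comp (Equiv.addRight (i - c))]
  refine Finset.sum_congr rfl fun k _ => ?_
  have : ψ (j * (k + (i - c))) = ψ (j * i) * ψ (-(j * c)) * ψ (j * k) := by
    rw [← AddChar.map_add_eq_mul, ← AddChar.map_add_eq_mul]; congr 1; ring
  simp only [Equiv.coe_addRight, this]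
  rw [show c + (k + (i - c)) - i = k by ring]
  ring

end

theorem two_mul_self_eq_zero (n : ℕ) : (n : ZMod (2 * n)) + n = 0 := by
  have := ZMod.natCast_self (2 * n)
  push_cast at this
  rw [← two_mul, this]

theorem neg_self_natCast (n : ℕ) : -(n : ZMod (2 * n)) = n :=
  neg_eq_of_add_eq_zero_left (two_mul_self_eq_zero n)

/-- The determinant is the product of the `2 × 2` determinants of the representations induced from
the characters of `⟨a 1⟩`: the Fourier matrix on both cosets of `⟨a 1⟩` block-diagonalizes the
group matrix. -/
theorem groupDeterminant_eq_prod {n : ℕ} [NeZero n] {R : Type*} [CommRing R] [IsDomain R]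
    [CharZero R] {ψ : AddChar (ZMod (2 * n)) R} (hψ : ψ.IsPrimitive) (x : QuaternionGroup n → ℤ) :
    ((groupDeterminant x : ℤ) : R) = ∏ j, quaternionFactor ψ x j := by
  set V := Matrix.kroneckerMap (· * ·) (1 : Matrix (Fin 2) (Fin 2) R)
      (Matrix.of fun i j : ZMod (2 * n) => ψ (j * i)) with hV
  set F : ZMod (2 * n) → R := charSum ψ fun i => x (.a i) with hF
  set G : ZMod (2 * n) → R := charSum ψ fun i => x (.xa i) with hG
  set B : ZMod (2 * n) → Matrix (Fin 2) (Fin 2) R := fun j =>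
    !![F (-j), ψ (j * n) * G j; G (-j), F j] with hB
  set M : Matrix (Fin 2 × ZMod (2 * n)) (Fin 2 × ZMod (2 * n)) R :=
    Matrix.of fun p q => ((x (quaternionEquiv n p * (quaternionEquiv n q)⁻¹) : ℤ) : R) with hM
  have hdet : ((groupDeterminant x : ℤ) : R) = M.det := by
    rw [groupDeterminant, ← eq_intCast (Int.castRingHom R), RingHom.map_det,
      ← Matrix.det_submatrix_equiv_self (quaternionEquiv n)]
    rfl
  have hinv_a (j : ZMod (2 * n)) : (QuaternionGroup.a j)⁻¹ = .a (-j) := rfl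
  have hinv_xa (j : ZMod (2 * n)) : (QuaternionGroup.xa j)⁻¹ = .xa (n + j) := rfl
  have hn2 := two_mul_self_eq_zero n
  have key : M * V = V * Matrix.blockDiagonal B := by
    ext ⟨b, i⟩ ⟨c, j⟩
    have hl : (M * V) (b, i) (c, j) = ∑ k, M (b, i) (c, k) * ψ (j * k) := by
      simp only [Matrix.mul_apply, Fintype.sum_prod_type, hV,
        Matrix.kroneckerMap_apply, Matrix.one_apply, Matrix.of_apply, ite_mul, one_mul, zero_mul,
        mul_ite, mul_zero]
      rw [Finset.sum_comm]
      simp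
    have hr : (V * Matrix.blockDiagonal B) (b, i) (c, j) = ψ (j * i) * B j b c := by
      simp only [Matrix.mul_apply, Fintype.sum_prod_type, hV,
        Matrix.kroneckerMap_apply, Matrix.one_apply, Matrix.of_apply, ite_mul, one_mul, zero_mul,
        Matrix.blockDiagonal_apply, mul_ite, mul_zero]
      simp
    rw [hl, hr]
    have hψn : ψ (-(j * n)) = ψ (j * n) := by rw [← mul_neg, neg_self_natCast]
    fin_cases b <;> fin_cases c
    · have := sum_sub_mul_char ψ (fun i => x (.a i)) i j
      simpa [hM, hB, quaternionEquiv, hinv_a, sub_eq_add_neg] using this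
    · have := sum_add_sub_mul_char ψ (fun i => x (.xa i)) n i j
      rw [hψn] at this
      simpa [hM, hB, quaternionEquiv, hinv_xa] using this
    · have := sum_sub_mul_char ψ (fun i => x (.xa i)) i j
      simpa [hM, hB, quaternionEquiv, hinv_a, sub_eq_add_neg] using this
    · have := sum_add_sub_mul_char ψ (fun i => x (.a i)) 0 i j
      have e (k : ZMod (2 * n)) : (n : ZMod (2 * n)) + (n + k) - i = 0 + k - i := by
        rw [← add_assoc, hn2]
      simpa [hM, hB, quaternionEquiv, hinv_xa, e] using this
  have hd := congrArg Matrix.det key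
  rw [Matrix.det_mul, Matrix.det_mul, mul_comm] at hd
  rw [hdet, mul_left_cancel₀ (det_kronecker_fourier_ne_zero hψ) hd, Matrix.det_blockDiagonal]
  refine Finset.prod_congr rfl fun j _ => ?_
  simp only [hB, Matrix.det_fin_two_of, quaternionFactor, ← hF, ← hG]
  ring

theorem charSum_map {N : ℕ} [NeZero N] {R S : Type*} [CommRing R] [CommRing S] (φ : R →+* S)
    (ψ : AddChar (ZMod N) R) (ψ' : AddChar (ZMod N) S) (f : ZMod N → ℤ) (j j' : ZMod N)
    (h : ∀ i, φ (ψ (j * i)) = ψ' (j' * i)) : φ (charSum ψ f j) = charSum ψ' f j' := by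
  simp [charSum, h]

section
variable {n : ℕ} [NeZero n]

/-- The factors are compatible with ring homomorphisms; the second character may be the same one
twisted by an index `c`, as happens for Galois and Frobenius automorphisms. -/
theorem quaternionFactor_map {R S : Type*} [CommRing R] [CommRing S] (φ : R →+* S)
    (ψ : AddChar (ZMod (2 * n)) R) (ψ' : AddChar (ZMod (2 * n)) S) (x : QuaternionGroup n → ℤ)
    (c j : ZMod (2 * n)) (h : ∀ i, φ (ψ i) = ψ' (c * i)) :
    φ (quaternionFactor ψ x j) = quaternionFactor ψ' x (c * j) := by
  have h1 (k i : ZMod (2 * n)) : φ (ψ (k * i)) = ψ' (c * k * i) := by rw [h, mul_assoc]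
  rw [quaternionFactor, quaternionFactor, map_sub, map_mul, map_mul, map_mul,
    charSum_map φ ψ ψ' _ _ _ (h1 j), charSum_map φ ψ ψ' _ _ _ (h1 j),
    charSum_map φ ψ ψ' _ _ _ (h1 (-j)), charSum_map φ ψ ψ' _ _ _ (h1 (-j)), h1, mul_neg]

theorem quaternionFactor_neg {R : Type*} [CommRing R] (ψ : AddChar (ZMod (2 * n)) R)
    (x : QuaternionGroup n → ℤ) (j : ZMod (2 * n)) :
    quaternionFactor ψ x (-j) = quaternionFactor ψ x j := by
  have : -j * (n : ZMod (2 * n)) = j * n := by rw [neg_mul, ← mul_neg, neg_self_natCast]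
  rw [quaternionFactor, quaternionFactor, neg_neg, this]
  ring

end

section
open NumberField

/-! ### Integrality of products of factors over Galois-stable sets of characters -/

/-- A primitive additive character with values in the integers of the cyclotomic field. -/
theorem exists_isPrimitive_ringOfIntegers (N : ℕ) [NeZero N] (K : Type*) [Field K] [NumberField K]
    [IsCyclotomicExtension {N} ℚ K] : ∃ ψ : AddChar (ZMod N) (𝓞 K), ψ.IsPrimitive :=
  ⟨_, AddChar.zmodChar_primitive_of_primitive_root N
    (IsCyclotomicExtension.zeta_spec N ℚ K).toInteger_isPrimitiveRoot⟩

/-- Galois descent: an integer of the cyclotomic field is rational if it is fixed by all ring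
endomorphisms that act on the roots of unity by a unit exponent. -/
theorem exists_int_eq_of_fixed {N : ℕ} [NeZero N] {K : Type*} [Field K] [NumberField K]
    [IsCyclotomicExtension {N} ℚ K] (ψ : AddChar (ZMod N) (𝓞 K)) (y : 𝓞 K)
    (h : ∀ (φ : 𝓞 K →+* 𝓞 K) (c : (ZMod N)ˣ),
      (∀ i, φ (ψ i) = ψ (c * i)) → φ y = y) : ∃ m : ℤ, y = m := by
  have hζ := IsCyclotomicExtension.zeta_spec N ℚ K
  have : IsGalois ℚ K := IsCyclotomicExtension.isGalois {N} ℚ K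
  have hfix : ∀ σ : Gal(K/ℚ), σ (y : K) = y := by
    intro σ
    set c := hζ.autToPow ℚ σ
    -- every `N`-th root of unity is a power of `ζ`, so `σ` raises it to the power `c`
    have hpow (u : K) (hu : u ^ N = 1) : σ u = u ^ (c : ZMod N).val := by
      obtain ⟨i, -, rfl⟩ := hζ.eq_pow_of_pow_eq_one hu
      rw [map_pow, ← hζ.autToPow_spec ℚ σ, ← pow_mul, ← pow_mul, mul_comm]
    have hφ : ∀ i, RingOfIntegers.mapRingHom (σ : K →+* K) (ψ i) = ψ (c * i) := by
      intro i
      have hi : ψ (c * i) = ψ i ^ (c : ZMod N).val := by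
        rw [← AddChar.map_nsmul_eq_pow, nsmul_eq_mul, ZMod.natCast_zmod_val]
      have h1 : ψ i ^ N = 1 := by
        rw [← AddChar.map_nsmul_eq_pow, nsmul_eq_mul, ZMod.natCast_self, zero_mul,
          AddChar.map_zero_eq_one]
      rw [hi]
      apply RingOfIntegers.ext
      have := hpow (ψ i : K) (by
        simpa using congrArg (algebraMap (𝓞 K) K) h1)
      simpa using this
    have := congrArg (algebraMap (𝓞 K) K) (h _ c hφ)
    simpa using this
  obtain ⟨q, hq⟩ := (IsGalois.mem_range_algebraMap_iff_fixed (F := ℚ) (y : K)).2 hfix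
  have hint : IsIntegral ℤ q := by
    have : IsIntegral ℤ (algebraMap ℚ K q) := by rw [hq]; exact y.isIntegral_coe
    exact (isIntegral_algebraMap_iff (algebraMap ℚ K).injective).1 this
  obtain ⟨m, rfl⟩ := IsIntegrallyClosed.isIntegral_iff.1 hint
  refine ⟨m, RingOfIntegers.ext ?_⟩
  rw [← hq]
  simp

section
variable {N : ℕ}

/-- The elements of `S` with the smaller representative in `[0, N)` of the two in `{j, -j}`. -/
def halfSet (S : Finset (ZMod N)) : Finset (ZMod N) := S.filter fun j => j.val < (-j).val

theorem mem_halfSet {S : Finset (ZMod N)} {j : ZMod N} :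
    j ∈ halfSet S ↔ j ∈ S ∧ j.val < (-j).val := Finset.mem_filter

theorem halfSet_or [NeZero N] {S : Finset (ZMod N)} (hneg : ∀ j ∈ S, -j ∈ S) (hne : ∀ j ∈ S, -j ≠ j)
    {j : ZMod N} (hj : j ∈ S) : j ∈ halfSet S ∨ -j ∈ halfSet S := by
  have h : j.val ≠ (-j).val := fun h => hne j hj (ZMod.val_injective N h).symm
  rcases lt_or_gt_of_ne h with h | h
  · exact Or.inl (mem_halfSet.2 ⟨hj, h⟩)
  · exact Or.inr (mem_halfSet.2 ⟨hneg j hj, by rwa [neg_neg]⟩)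

theorem neg_notMem_halfSet {S : Finset (ZMod N)} {j : ZMod N} (hj : j ∈ halfSet S) :
    -j ∉ halfSet S := fun h => by
  have h1 := (mem_halfSet.1 hj).2
  have h2 := (mem_halfSet.1 h).2
  rw [neg_neg] at h2
  omega

theorem prod_eq_sq_halfSet [NeZero N] {R : Type*} [CommRing R] {S : Finset (ZMod N)}
    (hneg : ∀ j ∈ S, -j ∈ S) (hne : ∀ j ∈ S, -j ≠ j) {A : ZMod N → R}
    (hA : ∀ j, A (-j) = A j) : ∏ j ∈ S, A j = (∏ j ∈ halfSet S, A j) ^ 2 := by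
  rw [← Finset.prod_filter_mul_prod_filter_not S (fun j => j.val < (-j).val), sq]
  congr 1
  refine Finset.prod_nbij' (fun j => -j) (fun j => -j) ?_ ?_ ?_ ?_ ?_
  · intro j hj
    rw [Finset.mem_filter] at hj
    exact (halfSet_or hneg hne hj.1).resolve_left fun h => hj.2 (mem_halfSet.1 h).2
  · intro j hj
    rw [Finset.mem_filter]
    exact ⟨hneg j (mem_halfSet.1 hj).1,
      fun h => neg_notMem_halfSet hj (mem_halfSet.2 ⟨hneg j (mem_halfSet.1 hj).1, h⟩)⟩
  · simp
  · simp
  · simp [hA]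

/-- Multiplication by a unit permutes the pairs `{j, -j}` of a stable set. -/
theorem prod_halfSet_unit_mul [NeZero N] {R : Type*} [CommRing R] {S : Finset (ZMod N)}
    (hS : ∀ (c : (ZMod N)ˣ), ∀ j ∈ S, c * j ∈ S) (hne : ∀ j ∈ S, -j ≠ j) {A : ZMod N → R}
    (hA : ∀ j, A (-j) = A j) (c : (ZMod N)ˣ) :
    ∏ j ∈ halfSet S, A (c * j) = ∏ j ∈ halfSet S, A j := by
  have hneg : ∀ j ∈ S, -j ∈ S := fun j hj => by simpa using hS (-1) j hj
  have hmem {j : ZMod N} (hj : j ∈ halfSet S) : j ∈ S := (mem_halfSet.1 hj).1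
  set r : (ZMod N)ˣ → ZMod N → ZMod N := fun c j =>
    if c * j ∈ halfSet S then c * j else -(c * j) with hr
  have hr_mem (c : (ZMod N)ˣ) (j : ZMod N) (hj : j ∈ halfSet S) : r c j ∈ halfSet S := by
    by_cases h : c * j ∈ halfSet S
    · simpa only [hr, if_pos h] using h
    · simpa only [hr, if_neg h] using (halfSet_or hneg hne (hS c j (hmem hj))).resolve_left h
  have hr_inv (c : (ZMod N)ˣ) (j : ZMod N) (hj : j ∈ halfSet S) : r c⁻¹ (r c j) = j := by
    by_cases h : c * j ∈ halfSet S
    · simp only [hr, if_pos h, Units.inv_mul_cancel_left, if_pos hj]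
    · simp only [hr, if_neg h, mul_neg, Units.inv_mul_cancel_left, if_neg (neg_notMem_halfSet hj),
        neg_neg]
  refine Finset.prod_nbij' (r c) (r c⁻¹) (hr_mem c) (hr_mem c⁻¹) (hr_inv c) ?_ ?_
  · intro j hj
    simpa using hr_inv c⁻¹ j hj
  · intro j _
    by_cases h : c * j ∈ halfSet S
    · simp only [hr, if_pos h]
    · simp only [hr, if_neg h, hA]

end

section
variable {n : ℕ} [NeZero n] {K : Type*} [Field K] [NumberField K]
  [IsCyclotomicExtension {2 * n} ℚ K] (ψ : AddChar (ZMod (2 * n)) (𝓞 K))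
  (x : QuaternionGroup n → ℤ) {S : Finset (ZMod (2 * n))}

theorem exists_int_eq_prod (hS : ∀ (c : (ZMod (2 * n))ˣ), ∀ j ∈ S, c * j ∈ S) :
    ∃ m : ℤ, ∏ j ∈ S, quaternionFactor ψ x j = m := by
  refine exists_int_eq_of_fixed ψ _ fun φ c hφ => ?_
  rw [map_prod]
  refine Finset.prod_nbij' (fun j => c * j) (fun j => (c⁻¹ : (ZMod (2 * n))ˣ) * j) (hS c) (hS c⁻¹)
    ?_ ?_ ?_
  · simp
  · simp
  · exact fun j _ => quaternionFactor_map φ ψ ψ x c j hφ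

/-- Characters come in inverse pairs with equal factors, so the product over a Galois-stable set of
characters, none of them its own inverse, is the square of a rational integer. -/
theorem exists_int_sq_eq_prod (hS : ∀ (c : (ZMod (2 * n))ˣ), ∀ j ∈ S, c * j ∈ S)
    (hne : ∀ j ∈ S, -j ≠ j) :
    ∃ q : ℤ, ∏ j ∈ S, quaternionFactor ψ x j = (q : 𝓞 K) ^ 2 := by
  obtain ⟨q, hq⟩ := exists_int_eq_of_fixed ψ (∏ j ∈ halfSet S, quaternionFactor ψ x j) <| by
    intro φ c hφ
    rw [map_prod, ← prod_halfSet_unit_mul hS hne (quaternionFactor_neg ψ x) c]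
    exact Finset.prod_congr rfl fun j _ => quaternionFactor_map φ ψ ψ x c j hφ
  refine ⟨q, ?_⟩
  rw [← hq]
  exact prod_eq_sq_halfSet (fun j hj => by simpa using hS (-1) j hj) hne (quaternionFactor_neg ψ x)

end

/-! ### Divisibility of determinants by primes dividing the order of the group -/

theorem exists_isPrime_intCast_mem_iff (K : Type*) [Field K] [NumberField K] (p : ℕ)
    [hp : Fact p.Prime] : ∃ P : Ideal (𝓞 K), P.IsPrime ∧ ∀ m : ℤ, (m : 𝓞 K) ∈ P ↔ (p : ℤ) ∣ m := by
  have hp' : Prime (p : ℤ) := Nat.prime_iff_prime_int.1 hp.out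
  have : (Ideal.span {(p : ℤ)}).IsPrime := (Ideal.span_singleton_prime hp'.ne_zero).2 hp'
  have : (Ideal.span {(p : ℤ)}).IsMaximal :=
    Ideal.IsPrime.isMaximal this (by simpa using hp'.ne_zero)
  obtain ⟨P, hP, h⟩ := Ideal.exists_ideal_over_maximal_of_isIntegral (S := 𝓞 K)
    (Ideal.span {(p : ℤ)}) (by
      rw [(RingHom.injective_iff_ker_eq_bot _).1 (algebraMap ℤ (𝓞 K)).injective_int]
      exact bot_le)
  refine ⟨P, hP.isPrime, fun m => ?_⟩
  rw [← Ideal.mem_span_singleton, ← h, Ideal.mem_comap]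
  simp

section
variable {n : ℕ} [NeZero n] {R : Type*} [CommRing R] (ψ : AddChar (ZMod (2 * n)) R)
  (x : QuaternionGroup n → ℤ) {p : ℕ} [hp : Fact p.Prime] {P : Ideal R} [hP : P.IsPrime]

/-- The Frobenius of the residue ring of a prime above `p` sends the factor at `j` to the factor at
`p * j`. -/
theorem quaternionFactor_prime_mul_mem_iff (hpP : (p : R) ∈ P) (j : ZMod (2 * n)) :
    quaternionFactor ψ x (p * j) ∈ P ↔ quaternionFactor ψ x j ∈ P := by
  have : CharP (R ⧸ P) p := ringChar.of_eq <| CharP.ringChar_of_prime_eq_zero hp.out <| by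
    rw [← map_natCast (Ideal.Quotient.mk P), Ideal.Quotient.eq_zero_iff_mem]
    exact hpP
  have h := quaternionFactor_map ((frobenius (R ⧸ P) p).comp (Ideal.Quotient.mk P)) ψ
    ((Ideal.Quotient.mk P : R →* R ⧸ P).compAddChar ψ) x p j fun i => by
      have : ψ (p * i) = ψ i ^ p := by rw [← AddChar.map_nsmul_eq_pow, nsmul_eq_mul]
      simp [frobenius_def, this]
  have h' := quaternionFactor_map (Ideal.Quotient.mk P) ψ
    ((Ideal.Quotient.mk P : R →* R ⧸ P).compAddChar ψ) x 1 (p * j) fun i => by simp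
  rw [one_mul] at h'
  rw [← h', RingHom.comp_apply, frobenius_def] at h
  rw [← Ideal.Quotient.eq_zero_iff_mem, ← Ideal.Quotient.eq_zero_iff_mem, ← h, pow_eq_zero_iff
    hp.out.ne_zero]

theorem quaternionFactor_prime_pow_mul_mem_iff (hpP : (p : R) ∈ P) (a : ℕ) (j : ZMod (2 * n)) :
    quaternionFactor ψ x (p ^ a * j) ∈ P ↔ quaternionFactor ψ x j ∈ P := by
  induction a with
  | zero => simp
  | succ a ih =>
    rw [← ih, ← quaternionFactor_prime_mul_mem_iff ψ x hpP (p ^ a * j), ← mul_assoc, pow_succ']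

theorem quaternionFactor_mem_of_prime_mul_eq (hpP : (p : R) ∈ P) {i j : ZMod (2 * n)}
    (hij : p * i = p * j) (h : quaternionFactor ψ x i ∈ P) : quaternionFactor ψ x j ∈ P := by
  rwa [← quaternionFactor_prime_mul_mem_iff ψ x hpP, ← hij,
    quaternionFactor_prime_mul_mem_iff ψ x hpP]

end

section
variable {n : ℕ} [NeZero n]

/-- Let `n = p ^ a * m` with `p ∤ m`. The characters of order dividing `2 * m` contribute a rational
integer, the other ones the square of a rational integer, and by the Frobenius both are divisible
by `p` as soon as one factor lies in a prime above `p`. -/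
theorem prime_pow_three_dvd_groupDeterminant {p : ℕ} [hp : Fact p.Prime] (hp2 : p ≠ 2)
    (hpn : p ∣ n) (x : QuaternionGroup n → ℤ) (h : (p : ℤ) ∣ groupDeterminant x) :
    (p : ℤ) ^ 3 ∣ groupDeterminant x := by
  let K := CyclotomicField (2 * n) ℚ
  have : NeZero ((2 * n : ℕ) : ℚ) := NeZero.charZero
  have : IsCyclotomicExtension {2 * n} ℚ K := CyclotomicField.isCyclotomicExtension (2 * n) ℚ
  obtain ⟨ψ, hψ⟩ := exists_isPrimitive_ringOfIntegers (2 * n) K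
  obtain ⟨P, hP, hPm⟩ := exists_isPrime_intCast_mem_iff K p
  have hpP : (p : 𝓞 K) ∈ P := by simpa using (hPm p).2 dvd_rfl
  obtain ⟨a, m, hm, hnm⟩ := Nat.exists_eq_pow_mul_and_not_dvd (NeZero.ne n) p hp.out.ne_one
  have hD := groupDeterminant_eq_prod hψ x
  set A := quaternionFactor ψ x
  set S : Finset (ZMod (2 * n)) := Finset.univ.filter fun j => ((2 * m : ℕ) : ZMod (2 * n)) * j = 0
    with hS
  have hSmem (j : ZMod (2 * n)) : j ∈ S ↔ ((2 * m : ℕ) : ZMod (2 * n)) * j = 0 := by simp [hS]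
  have hSu (c : (ZMod (2 * n))ˣ) (j : ZMod (2 * n)) : c * j ∈ S ↔ j ∈ S := by
    rw [hSmem, hSmem, mul_left_comm, Units.mul_right_eq_zero]
  obtain ⟨e, he⟩ := exists_int_eq_prod ψ x (S := S) fun c j => (hSu c j).2
  obtain ⟨q, hq⟩ := exists_int_sq_eq_prod ψ x (S := Sᶜ)
    (fun c j hj => by simpa only [Finset.mem_compl, hSu] using hj) fun j hj hneg => by
      refine Finset.mem_compl.1 hj ((hSmem j).2 ?_)
      have : (2 : ZMod (2 * n)) * j = 0 := by linear_combination -hneg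
      push_cast
      rw [mul_right_comm, this, zero_mul]
  have hDeq : groupDeterminant x = e * q ^ 2 := by
    rw [← Finset.prod_mul_prod_compl S, he, hq] at hD
    exact_mod_cast hD
  -- some factor lies in `P`, hence by the Frobenius one at an index `j ∈ S`
  have hDP : ∏ j, A j ∈ P := by rw [← hD]; exact (hPm _).2 h
  obtain ⟨i, -, hi⟩ := hP.prod_mem_iff.1 hDP
  have hj : A (p ^ a * i) ∈ P := (quaternionFactor_prime_pow_mul_mem_iff ψ x hpP a i).2 hi
  set j := (p ^ a * i : ZMod (2 * n))
  have hjS : j ∈ S := by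
    rw [hSmem, ← mul_assoc]
    have : ((2 * m : ℕ) * p ^ a : ZMod (2 * n)) = ((2 * n : ℕ) : ZMod (2 * n)) := by
      rw [← Nat.cast_pow, ← Nat.cast_mul, mul_assoc, mul_comm m, ← hnm]
    rw [this, ZMod.natCast_self, zero_mul]
  -- translating `j` by an index of order `p` leaves `S`
  obtain ⟨d, hd⟩ := hpn
  have hw : (p : ZMod (2 * n)) * (2 * d : ℕ) = 0 := by
    rw [← Nat.cast_mul, ZMod.natCast_eq_zero_iff, hd]
    exact ⟨1, by ring⟩
  have hj' : A (j + (2 * d : ℕ)) ∈ P :=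
    quaternionFactor_mem_of_prime_mul_eq ψ x hpP (by rw [mul_add, hw, add_zero]) hj
  have hj'S : j + (2 * d : ℕ) ∈ Sᶜ := by
    rw [Finset.mem_compl, hSmem, mul_add, (hSmem j).1 hjS, zero_add, ← Nat.cast_mul,
      ZMod.natCast_eq_zero_iff]
    intro hdvd
    have hd0 : 0 < 2 * d := by
      have := NeZero.ne n
      rcases Nat.eq_zero_or_pos d with rfl | hd'
      · simp at hd; omega
      · omega
    have h1 : p * (2 * d) ∣ 2 * m * (2 * d) := by
      rwa [show p * (2 * d) = 2 * n by rw [hd]; ring]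
    have h2 : p ∣ 2 * m := Nat.dvd_of_mul_dvd_mul_right hd0 h1
    rcases hp.out.dvd_mul.1 h2 with h3 | h3
    · exact hp2 ((Nat.prime_dvd_prime_iff_eq hp.out Nat.prime_two).1 h3)
    · exact hm h3
  have hpe : (p : ℤ) ∣ e := by
    rw [← hPm, ← he]
    exact hP.prod_mem_iff.2 ⟨j, hjS, hj⟩
  have hpq : (p : ℤ) ∣ q := by
    rw [← hPm]
    refine hP.mem_of_pow_mem 2 ?_
    rw [← hq]
    exact hP.prod_mem_iff.2 ⟨_, hj'S, hj'⟩
  rw [hDeq, pow_succ']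
  exact mul_dvd_mul hpe (pow_dvd_pow_of_dvd hpq 2)

theorem char_natCast_self {R : Type*} [CommRing R] [IsDomain R] {ψ : AddChar (ZMod (2 * n)) R}
    (hψ : ψ.IsPrimitive) : ψ n = -1 := by
  have h1 : ψ n * ψ n = 1 := by
    rw [← AddChar.map_add_eq_mul, two_mul_self_eq_zero, AddChar.map_zero_eq_one]
  refine (mul_self_eq_one_iff.1 h1).resolve_left fun h => ?_
  have hn0 := char_eq_one_iff hψ |>.1 h
  rw [ZMod.natCast_eq_zero_iff] at hn0
  have := Nat.le_of_dvd (NeZero.pos n) hn0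
  have := NeZero.pos n
  omega

/-- The value of an integer group ring element at the character of order two is a rational integer,
congruent modulo `2` to the value at the trivial character. -/
theorem charSum_natCast_self {R : Type*} [CommRing R] [IsDomain R] {ψ : AddChar (ZMod (2 * n)) R}
    (hψ : ψ.IsPrimitive) (f : ZMod (2 * n) → ℤ) :
    ∃ m : ℤ, charSum ψ f n = m ∧ (2 : ℤ) ∣ m - ∑ i, f i := by
  refine ⟨∑ i, f i * (-1) ^ i.val, ?_, ?_⟩
  · rw [charSum, Int.cast_sum]
    refine Finset.sum_congr rfl fun i _ => ?_
    rw [char_mul_eq_pow, char_natCast_self hψ]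
    simp
  · rw [← Finset.sum_sub_distrib]
    refine Finset.dvd_sum fun i _ => ?_
    rcases neg_one_pow_eq_or ℤ i.val with h | h <;> rw [h]
    · simp
    · exact ⟨-f i, by ring⟩

/-- For odd `F`, `G` the first factor is divisible by `8` and the second by `2`; for even `F`, `G`
both are divisible by `4`. -/
theorem sixteen_dvd_of_even {F G F' G' : ℤ} (hF : 2 ∣ F' - F) (hG : 2 ∣ G' - G) (h : 2 ∣ F - G) :
    16 ∣ (F ^ 2 - G ^ 2) * (F' ^ 2 + G' ^ 2) := by
  obtain ⟨a, ha⟩ := hF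
  obtain ⟨b, hb⟩ := hG
  obtain ⟨c, hc⟩ := h
  obtain rfl : F' = G + 2 * (a + c) := by linarith
  obtain rfl : G' = G + 2 * b := by linarith
  obtain rfl : F = G + 2 * c := by linarith
  rcases Int.even_or_odd' G with ⟨k, rfl | rfl⟩
  · exact ⟨((k + c) ^ 2 - k ^ 2) * ((k + (a + c)) ^ 2 + (k + b) ^ 2), by ring⟩
  · obtain ⟨t, ht⟩ : (2 : ℤ) ∣ c * (c + 1) := (Int.even_mul_succ_self c).two_dvd
    refine ⟨(t + c * k) *
      (2 * (k + (a + c)) ^ 2 + 2 * (k + (a + c)) + 2 * (k + b) ^ 2 + 2 * (k + b) + 1), ?_⟩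
    linear_combination 4 * ((2 * k + 1 + 2 * (a + c)) ^ 2 + (2 * k + 1 + 2 * b) ^ 2) * ht

/-- The factors at the four linear characters multiply to `(F² - G²) (F'² + G'²)` with `F ≡ F'` and
`G ≡ G'` modulo `2`. The other factors form two squares, over the characters of even and of odd
index, which are interchanged by the translation by `n`, and this translation does not change the
factors modulo a prime above `2`. -/
theorem sixteen_dvd_groupDeterminant (hn : Odd n) (x : QuaternionGroup n → ℤ)
    (h : 2 ∣ groupDeterminant x) : 16 ∣ groupDeterminant x := by
  let K := CyclotomicField (2 * n) ℚ
  have : NeZero ((2 * n : ℕ) : ℚ) := NeZero.charZero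
  have : IsCyclotomicExtension {2 * n} ℚ K := CyclotomicField.isCyclotomicExtension (2 * n) ℚ
  have : Fact (Nat.Prime 2) := ⟨Nat.prime_two⟩
  obtain ⟨ψ, hψ⟩ := exists_isPrimitive_ringOfIntegers (2 * n) K
  obtain ⟨P, hP, hPm⟩ := exists_isPrime_intCast_mem_iff K 2
  have hpP : ((2 : ℕ) : 𝓞 K) ∈ P := by simpa using (hPm 2).2 dvd_rfl
  have hD := groupDeterminant_eq_prod hψ x
  set A := quaternionFactor ψ x with hA
  obtain ⟨k, hk⟩ := hn
  have hnk : (n : ZMod (2 * n)) = 2 * k + 1 := by exact_mod_cast congrArg Nat.cast hk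
  have hnn : (2 : ZMod (2 * n)) * n = 0 := by
    linear_combination two_mul_self_eq_zero n
  have hpar (v : ℕ) : (n : ZMod (2 * n)) * v = 0 ↔ 2 ∣ v := by
    rw [← Nat.cast_mul, ZMod.natCast_eq_zero_iff, mul_comm 2]
    exact Nat.mul_dvd_mul_iff_left (NeZero.pos n)
  have hshift (j : ZMod (2 * n)) :
      (n : ZMod (2 * n)) * (j + n) = 0 ↔ ¬ (n : ZMod (2 * n)) * j = 0 := by
    rw [← ZMod.natCast_zmod_val j, ← Nat.cast_add, hpar, hpar]
    omega
  set S₀ : Finset (ZMod (2 * n)) := Finset.univ.filter fun j => 2 * j = 0 with hS₀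
  set S₁ : Finset (ZMod (2 * n)) := S₀ᶜ.filter fun j => n * j = 0 with hS₁
  set S₂ : Finset (ZMod (2 * n)) := S₀ᶜ.filter fun j => ¬ n * j = 0 with hS₂
  have h2u (c : (ZMod (2 * n))ˣ) (j : ZMod (2 * n)) :
      (2 : ZMod (2 * n)) * (c * j) = 0 ↔ 2 * j = 0 := by
    rw [mul_left_comm, Units.mul_right_eq_zero]
  have hnu (c : (ZMod (2 * n))ˣ) (j : ZMod (2 * n)) :
      (n : ZMod (2 * n)) * (c * j) = 0 ↔ n * j = 0 := by
    rw [mul_left_comm, Units.mul_right_eq_zero]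
  have hne (j : ZMod (2 * n)) (hj : ¬ 2 * j = 0) : -j ≠ j := fun h => hj (by linear_combination -h)
  obtain ⟨q₁, hq₁⟩ := exists_int_sq_eq_prod ψ x (S := S₁)
    (fun c j hj => by simpa [hS₁, hS₀, h2u, hnu] using hj)
    fun j hj => hne j (by simp [hS₁, hS₀] at hj; exact hj.1)
  obtain ⟨q₂, hq₂⟩ := exists_int_sq_eq_prod ψ x (S := S₂)
    (fun c j hj => by simpa [hS₂, hS₀, h2u, hnu] using hj)
    fun j hj => hne j (by simp [hS₂, hS₀] at hj; exact hj.1)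
  have hn0 : (n : ZMod (2 * n)) ≠ 0 := by
    intro h0
    have h1 := char_natCast_self hψ
    rw [h0, AddChar.map_zero_eq_one] at h1
    have h2 : ((2 : ℤ) : 𝓞 K) = 0 := by push_cast; linear_combination h1
    exact two_ne_zero (Int.cast_eq_zero.1 h2)
  have hS₀eq : S₀ = {0, (n : ZMod (2 * n))} := by
    ext j
    simp only [hS₀, Finset.mem_filter, Finset.mem_univ, true_and, Finset.mem_insert,
      Finset.mem_singleton]
    constructor
    · intro hj
      have hjn : (2 : ZMod (2 * n)) * (j + n) = 0 := by
        rw [mul_add, hj, hnn, add_zero]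
      -- `n` being odd, only `0` is annihilated by both `2` and `n`
      have hzero (i : ZMod (2 * n)) (hi : 2 * i = 0) (hi' : (n : ZMod (2 * n)) * i = 0) :
          i = 0 := by
        rw [hnk] at hi'
        linear_combination hi' - k * hi
      by_cases hj' : (n : ZMod (2 * n)) * j = 0
      · exact Or.inl (hzero j hj hj')
      · have := hzero _ hjn ((hshift j).2 hj')
        right
        rw [← neg_self_natCast]
        exact eq_neg_of_add_eq_zero_left this
    · rintro (rfl | rfl)
      · simp
      · exact hnn
  -- the four linear characters
  obtain ⟨F', hF', hFF⟩ := charSum_natCast_self hψ fun i => x (.a i)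
  obtain ⟨G', hG', hGG⟩ := charSum_natCast_self hψ fun i => x (.xa i)
  set F := ∑ i, x (.a i)
  set G := ∑ i, x (.xa i)
  have hA0 : A 0 = ((F ^ 2 - G ^ 2 : ℤ) : 𝓞 K) := by
    simp [hA, quaternionFactor, charSum, F, G]
    ring
  have hAn : A n = ((F' ^ 2 + G' ^ 2 : ℤ) : 𝓞 K) := by
    have : (n : ZMod (2 * n)) * n = n := by linear_combination n * hnk + k * hnn
    rw [hA, quaternionFactor, neg_self_natCast, hF', hG', this, char_natCast_self hψ]
    push_cast
    ring
  have hDeq : groupDeterminant x = (F ^ 2 - G ^ 2) * (F' ^ 2 + G' ^ 2) * (q₁ ^ 2 * q₂ ^ 2) := by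
    rw [← Finset.prod_mul_prod_compl S₀,
      ← Finset.prod_filter_mul_prod_filter_not S₀ᶜ (fun j => n * j = 0), hq₁, hq₂, hS₀eq,
      Finset.prod_pair hn0.symm, hA0, hAn] at hD
    exact_mod_cast hD
  have hDP : ∏ j, A j ∈ P := by rw [← hD]; exact (hPm _).2 (by exact_mod_cast h)
  obtain ⟨i, -, hi⟩ := hP.prod_mem_iff.1 hDP
  rw [hDeq]
  by_cases hi2 : 2 * i = 0
  · refine (sixteen_dvd_of_even hFF hGG ?_).mul_right _
    have : i = 0 ∨ i = n := by
      have : i ∈ S₀ := by simpa [hS₀] using hi2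
      simpa [hS₀eq] using this
    rcases this with rfl | rfl
    · rw [hA0, hPm] at hi
      have : Even (F ^ 2 - G ^ 2) := even_iff_two_dvd.2 (by exact_mod_cast hi)
      rw [← even_iff_two_dvd]
      simpa [Int.even_sub, Int.even_pow] using this
    · rw [hAn, hPm] at hi
      have : Even (F' ^ 2 + G' ^ 2) := even_iff_two_dvd.2 (by exact_mod_cast hi)
      have h' : (2 : ℤ) ∣ F' - G' := by
        rw [← even_iff_two_dvd]
        simpa [Int.even_sub, Int.even_add, Int.even_pow] using this
      omega
  · have hi' : A (i + n) ∈ P := quaternionFactor_mem_of_prime_mul_eq ψ x hpP (by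
      push_cast
      rw [mul_add, hnn, add_zero]) hi
    have hi'2 : ¬ 2 * (i + n) = 0 := by
      rwa [mul_add, hnn, add_zero]
    have h12 : (∃ j ∈ S₁, A j ∈ P) ∧ ∃ j ∈ S₂, A j ∈ P := by
      by_cases hni : (n : ZMod (2 * n)) * i = 0
      · exact ⟨⟨i, by simp [hS₁, hS₀, hi2, hni], hi⟩, i + n, by
          simp only [hS₂, hS₀, Finset.mem_filter, Finset.mem_compl, Finset.mem_univ, true_and,
            hshift]; exact ⟨hi'2, not_not.2 hni⟩, hi'⟩
      · exact ⟨⟨i + n, by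
          simp only [hS₁, hS₀, Finset.mem_filter, Finset.mem_compl, Finset.mem_univ, true_and,
            hshift]; exact ⟨hi'2, hni⟩, hi'⟩, i, by simp [hS₂, hS₀, hi2, hni], hi⟩
    have hq₁P : (2 : ℤ) ∣ q₁ := by
      rw [← Nat.cast_two, ← hPm]
      exact hP.mem_of_pow_mem 2 (hq₁ ▸ hP.prod_mem_iff.2 h12.1)
    have hq₂P : (2 : ℤ) ∣ q₂ := by
      rw [← Nat.cast_two, ← hPm]
      exact hP.mem_of_pow_mem 2 (hq₂ ▸ hP.prod_mem_iff.2 h12.2)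
    exact (mul_dvd_mul (pow_dvd_pow_of_dvd hq₁P 2) (pow_dvd_pow_of_dvd hq₂P 2)).mul_left _

end

end

/-! ### Group ring elements of prescribed determinant -/

section
variable {n : ℕ} [NeZero n] {R : Type*} [CommRing R]

/-- The ring of functions on the characters `i ↦ χ (l * i)` of `ZMod n`, indexed by `l`, that are
Fourier transforms of integer-valued functions. -/
def fourierRing (χ : AddChar (ZMod n) R) : Subring (ZMod n → R) where
  carrier := Set.range (charSum χ)
  mul_mem' := by
    rintro _ _ ⟨f, rfl⟩ ⟨g, rfl⟩
    refine ⟨fun i => ∑ k, f k * g (i - k), funext fun l => ?_⟩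
    rw [Pi.mul_apply, charSum, charSum, Finset.sum_mul]
    simp only [Int.cast_sum, Finset.sum_mul, Int.cast_mul]
    rw [Finset.sum_comm]
    refine Finset.sum_congr rfl fun k _ => ?_
    rw [charSum, Finset.mul_sum, ← Equiv.sum_comp (Equiv.addRight k)]
    refine Finset.sum_congr rfl fun i _ => ?_
    simp only [Equiv.coe_addRight, add_sub_cancel_right, mul_add, AddChar.map_add_eq_mul]
    ring
  one_mem' := ⟨Pi.single 0 1, by ext l; simp [charSum, Pi.single_apply]⟩
  add_mem' := by
    rintro _ _ ⟨f, rfl⟩ ⟨g, rfl⟩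
    exact ⟨f + g, by ext l; simp [charSum, add_mul, Finset.sum_add_distrib]⟩
  zero_mem' := ⟨0, by ext l; simp [charSum]⟩
  neg_mem' := by
    rintro _ ⟨f, rfl⟩
    exact ⟨-f, by ext l; simp [charSum]⟩

theorem char_mem_fourierRing (χ : AddChar (ZMod n) R) (a : ZMod n) :
    (fun l => χ (a * l)) ∈ fourierRing χ :=
  ⟨Pi.single a 1, by ext l; simp [charSum, Pi.single_apply, mul_comm]⟩

/-- The Fourier transform of the constant function `1`. -/
theorem ite_mem_fourierRing [IsDomain R] {χ : AddChar (ZMod n) R} (hχ : χ.IsPrimitive) :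
    (fun l => if l = 0 then (n : R) else 0) ∈ fourierRing χ := by
  refine ⟨1, ?_⟩
  ext l
  have := AddChar.sum_mulShift l hχ
  rw [ZMod.card] at this
  simp [charSum, mul_comm l, this]

/-- The group ring element with `a`-part `U + (1 + ε) h` and `xa`-part `(1 + ε) h`, where `ε` is the
central involution and `U`, `h` are supported on the subgroup of order `n`. -/
theorem exists_groupDeterminant_eq [IsDomain R] [CharZero R] (hn : Odd n)
    {χ : AddChar (ZMod n) R} (hχ : χ.IsPrimitive) {U h : ZMod n → R} (hU : U ∈ fourierRing χ)
    (hh : h ∈ fourierRing χ) : ∃ x : QuaternionGroup n → ℤ, ((groupDeterminant x : ℤ) : R) =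
      (∏ l, (U l * U (-l) + 2 * (U l * h (-l) + U (-l) * h l))) * ∏ l, U l * U (-l) := by
  obtain ⟨u, rfl⟩ := hU
  obtain ⟨v, rfl⟩ := hh
  -- `c : ZMod 2` records the value `± 1` of a character at the central involution
  let e := ZMod.chineseRemainder (Nat.coprime_two_left.2 hn)
  have hsq : (-1 : R) ^ 2 = 1 := by ring
  let s : AddChar (ZMod 2) R := AddChar.zmodChar 2 hsq
  have hs1 : s 1 = -1 := by
    have := AddChar.zmodChar_apply hsq (1 : ZMod 2)
    rw [this]; simp [ZMod.val_one]
  let ψ : AddChar (ZMod (2 * n)) R :=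
    { toFun := fun i => s (e i).1 * χ (e i).2
      map_zero_eq_one' := by simp
      map_add_eq_mul' := fun i j => by
        simp only [map_add, Prod.fst_add, Prod.snd_add, AddChar.map_add_eq_mul]; ring }
  have hψ_apply (i : ZMod (2 * n)) : ψ i = s (e i).1 * χ (e i).2 := rfl
  have hψ : ψ.IsPrimitive := by
    intro a ha h1
    have hall (c : ZMod 2) (l : ZMod n) : s ((e a).1 * c) * χ ((e a).2 * l) = 1 := by
      have := DFunLike.congr_fun h1 (e.symm (c, l))
      simpa [AddChar.mulShift_apply, hψ_apply] using this
    have h2 : (e a).2 = 0 := (char_eq_one_iff hχ).1 (by simpa using hall 0 1)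
    have h3 : s (e a).1 = 1 := by simpa using hall 1 0
    have h4 : (e a).1 = 0 := by
      generalize (e a).1 = c at h3
      fin_cases c
      · rfl
      · change s 1 = 1 at h3
        rw [hs1] at h3
        have h5 : ((2 : ℤ) : R) = 0 := by push_cast; linear_combination -h3
        exact absurd (Int.cast_eq_zero.1 h5) two_ne_zero
    exact ha (e.injective (by rw [map_zero]; exact Prod.ext h4 h2))
  have hen : e n = (1, 0) := by
    rw [map_natCast]
    refine Prod.ext ?_ ?_
    · simpa using ZMod.natCast_eq_one_iff_odd.2 hn
    · simp
  refine ⟨fun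
    | .a i => (if (e i).1 = 0 then u (e i).2 else 0) + v (e i).2
    | .xa i => v (e i).2, ?_⟩
  have hsum (F : ZMod 2 → R) : ∑ b, F b = F 0 + F 1 := Fin.sum_univ_two F
  have hprod (F : ZMod 2 → R) : ∏ b, F b = F 0 * F 1 := Fin.prod_univ_two F
  have hchar (c b : ZMod 2) (l k : ZMod n) :
      ψ (e.symm (c, l) * e.symm (b, k)) = s (c * b) * χ (l * k) := by
    rw [hψ_apply, ← map_mul, e.apply_symm_apply]; rfl
  have hv (c : ZMod 2) (l : ZMod n) :
      charSum ψ (fun i => v (e i).2) (e.symm (c, l)) = (1 + s c) * charSum χ v l := by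
    rw [charSum, ← Equiv.sum_comp e.symm.toEquiv, Fintype.sum_prod_type, hsum]
    simp only [RingEquiv.toEquiv_eq_coe, RingEquiv.coe_toEquiv, e.apply_symm_apply, hchar, mul_zero,
      mul_one, AddChar.map_zero_eq_one, one_mul]
    rw [add_mul, one_mul, charSum, Finset.mul_sum]
    congr 1
    exact Finset.sum_congr rfl fun k _ => by ring
  have hu (c : ZMod 2) (l : ZMod n) :
      charSum ψ (fun i => (if (e i).1 = 0 then u (e i).2 else 0) + v (e i).2) (e.symm (c, l)) =
        charSum χ u l + (1 + s c) * charSum χ v l := by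
    rw [← hv, charSum, charSum]
    simp only [Int.cast_add, add_mul, Finset.sum_add_distrib]
    congr 1
    rw [← Equiv.sum_comp e.symm.toEquiv, Fintype.sum_prod_type, hsum]
    simp [hchar]
  have hneg (c : ZMod 2) (l : ZMod n) : -e.symm (c, l) = e.symm (c, -l) := by
    rw [← map_neg]
    congr 1
    exact Prod.ext (CharTwo.neg_eq c) rfl
  have hcn (c : ZMod 2) (l : ZMod n) : ψ (e.symm (c, l) * n) = s c := by
    rw [← e.symm_apply_apply (n : ZMod (2 * n)), hen, hchar, mul_one, mul_zero,
      AddChar.map_zero_eq_one, mul_one]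
  rw [groupDeterminant_eq_prod hψ, ← Equiv.prod_comp e.symm.toEquiv, Fintype.prod_prod_type, hprod]
  congr 1
  · refine Finset.prod_congr rfl fun l _ => ?_
    simp only [RingEquiv.toEquiv_eq_coe, RingEquiv.coe_toEquiv, quaternionFactor, hneg, hu, hv, hcn,
      AddChar.map_zero_eq_one]
    ring
  · refine Finset.prod_congr rfl fun l _ => ?_
    simp only [RingEquiv.toEquiv_eq_coe, RingEquiv.coe_toEquiv, quaternionFactor, hneg, hu, hv, hcn,
      hs1]
    ring

theorem prod_unit_mul_compl_zero (V : ZMod n → R) {q : ℕ} (hq : q.Coprime n) :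
    ∏ l ∈ {0}ᶜ, V (q * l) = ∏ l ∈ {0}ᶜ, V l := by
  rw [← ZMod.coe_unitOfCoprime q hq]
  generalize ZMod.unitOfCoprime q hq = c
  refine Finset.prod_nbij' (fun l => c * l) (fun l => (c⁻¹ : (ZMod n)ˣ) * l) ?_ ?_ ?_ ?_ ?_ <;> simp

/-- If `(χ l - 1) V l` is `χ (q l) - 1` up to roots of unity with product `1`, then `V` has norm `1`
away from the trivial character. -/
theorem prod_ne_zero_eq_one [IsDomain R] (hn : Odd n) {χ : AddChar (ZMod n) R}
    (hχ : χ.IsPrimitive) {q : ℕ} (hq : q.Coprime n) (a : ZMod n) {V : ZMod n → R}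
    (hV : ∀ l, (χ l - 1) * V l = χ (a * l) * (χ (q * l) - 1)) :
    ∏ l ∈ {0}ᶜ, V l = 1 := by
  have h1 : ∏ l ∈ ({0}ᶜ : Finset (ZMod n)), (χ l - 1) ≠ 0 := by
    refine Finset.prod_ne_zero_iff.2 fun l hl => ?_
    rw [sub_ne_zero, Ne, char_eq_one_iff hχ]
    simpa using hl
  have h2 : ∏ l ∈ ({0}ᶜ : Finset (ZMod n)), (χ (q * l) - 1) =
      ∏ l ∈ ({0}ᶜ : Finset (ZMod n)), (χ l - 1) :=
    prod_unit_mul_compl_zero (fun l => χ l - 1) hq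
  have h3 : ∏ l ∈ ({0}ᶜ : Finset (ZMod n)), χ (a * l) = 1 := by
    have hsum : ∑ l ∈ ({0}ᶜ : Finset (ZMod n)), a * l = 0 := by
      have h0 : ∑ l : ZMod n, a * l = -∑ l : ZMod n, a * l := by
        rw [← Finset.sum_neg_distrib, ← Equiv.sum_comp (Equiv.neg (ZMod n))]
        simp
      have hu : IsUnit (2 : ZMod n) := by
        simpa using (ZMod.isUnit_iff_coprime 2 n).2 (Nat.coprime_two_left.2 hn)
      have h00 : ∑ l : ZMod n, a * l = 0 := by
        refine (hu.mul_right_eq_zero).1 ?_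
        linear_combination h0
      rw [← Finset.sum_add_sum_compl {0}] at h00
      simpa using h00
    calc _ = χ (∑ l ∈ ({0}ᶜ : Finset (ZMod n)), a * l) :=
          (map_prod χ.toMonoidHom (fun l => Multiplicative.ofAdd (a * l)) _).symm
      _ = 1 := by rw [hsum, AddChar.map_zero_eq_one]
  have h4 := Finset.prod_congr (rfl : ({0}ᶜ : Finset (ZMod n)) = _) fun l _ => hV l
  rw [Finset.prod_mul_distrib, Finset.prod_mul_distrib, h2, h3, one_mul] at h4
  exact mul_left_cancel₀ h1 (by rw [h4, mul_one])

/-- The element `1 + t`, with `t` a generator of the subgroup of order `n`. -/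
theorem exists_groupDeterminant_eq_sixteen (hn : Odd n) :
    ∃ x : QuaternionGroup n → ℤ, groupDeterminant x = 16 := by
  have hζ := Complex.isPrimitiveRoot_exp n (NeZero.ne n)
  have hχ := AddChar.zmodChar_primitive_of_primitive_root n hζ
  set χ := AddChar.zmodChar n ((IsPrimitiveRoot.iff_def _ n).mp hζ).left
  have hU : (fun l => 1 + χ l) ∈ fourierRing χ :=
    add_mem (one_mem _) (by simpa using char_mem_fourierRing χ 1)
  obtain ⟨x, hx⟩ := exists_groupDeterminant_eq hn hχ hU (zero_mem _)
  have h1 : ∏ l ∈ {0}ᶜ, (1 + χ l) = 1 :=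
    prod_ne_zero_eq_one hn hχ (q := 2) (Nat.coprime_two_left.2 hn) 0 fun l => by
      rw [zero_mul, AddChar.map_zero_eq_one, one_mul, Nat.cast_two, two_mul, AddChar.map_add_eq_mul]
      ring
  have h2 : ∏ l, (1 + χ l) = 2 := by
    rw [← Finset.prod_mul_prod_compl {0}, h1, Finset.prod_singleton, AddChar.map_zero_eq_one]
    norm_num
  have h3 : ∏ l, (1 + χ (-l)) = 2 := by
    rw [← h2, ← Equiv.prod_comp (Equiv.neg (ZMod n))]
    simp
  refine ⟨x, ?_⟩
  simp only [Pi.zero_apply, mul_zero, add_zero, Finset.prod_mul_distrib, h2, h3] at hx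
  have : ((groupDeterminant x : ℤ) : ℂ) = ((16 : ℤ) : ℂ) := by rw [hx]; norm_num
  exact_mod_cast this

/-- The value at the character `l` of the symmetric geometric sum `∑ t ^ i`, `-k ≤ i ≤ k`. -/
def symmSum (χ : AddChar (ZMod n) R) (k : ℕ) (l : ZMod n) : R :=
  1 + ∑ i ∈ Finset.range k, (χ ((i + 1 : ℕ) * l) + χ (-((i + 1 : ℕ) * l)))

omit [NeZero n] in
theorem symmSum_succ (χ : AddChar (ZMod n) R) (k : ℕ) (l : ZMod n) : symmSum χ (k + 1) l =
    symmSum χ k l + (χ ((k + 1 : ℕ) * l) + χ (-((k + 1 : ℕ) * l))) := by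
  rw [symmSum, symmSum, Finset.sum_range_succ, add_assoc]

omit [NeZero n] in
theorem symmSum_neg (χ : AddChar (ZMod n) R) (k : ℕ) (l : ZMod n) :
    symmSum χ k (-l) = symmSum χ k l := by
  simp only [symmSum, mul_neg, neg_neg, add_comm (χ (-_))]

omit [NeZero n] in
theorem symmSum_zero (χ : AddChar (ZMod n) R) (k : ℕ) : symmSum χ k 0 = 2 * k + 1 := by
  simp [symmSum]
  ring

theorem symmSum_mem (χ : AddChar (ZMod n) R) (k : ℕ) (j : ZMod n) :
    (fun l => symmSum χ k (j * l)) ∈ fourierRing χ := by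
  induction k with
  | zero =>
    simp only [symmSum, Finset.range_zero, Finset.sum_empty, add_zero]
    exact one_mem (fourierRing χ)
  | succ k ih =>
    simp only [symmSum_succ]
    have h1 := char_mem_fourierRing χ ((k + 1 : ℕ) * j)
    have h2 := char_mem_fourierRing χ (-((k + 1 : ℕ) * j))
    simp only [neg_mul, mul_assoc] at h1 h2
    exact add_mem ih (add_mem h1 h2)

omit [NeZero n] in
theorem sub_one_mul_symmSum (χ : AddChar (ZMod n) R) (k : ℕ) (l : ZMod n) :
    (χ l - 1) * symmSum χ k l = χ (-(k * l)) * (χ ((2 * k + 1 : ℕ) * l) - 1) := by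
  have h : (χ l - 1) * symmSum χ k l = χ ((k + 1 : ℕ) * l) - χ (-(k * l)) := by
    induction k with
    | zero => simp [symmSum]
    | succ k ih =>
      have e1 : χ ((k + 1 + 1 : ℕ) * l) = χ l * χ ((k + 1 : ℕ) * l) := by
        rw [← AddChar.map_add_eq_mul]; push_cast; congr 1; ring
      have e2 : χ (-(k * l)) = χ l * χ (-((k + 1 : ℕ) * l)) := by
        rw [← AddChar.map_add_eq_mul]; push_cast; congr 1; ring
      rw [symmSum_succ, mul_add, ih, e1, e2]
      ring
  rw [h, mul_sub, ← AddChar.map_add_eq_mul, mul_one]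
  push_cast
  congr 2
  ring

theorem prod_symmSum [IsDomain R] (hn : Odd n) {χ : AddChar (ZMod n) R} (hχ : χ.IsPrimitive)
    {k : ℕ} (hk : (2 * k + 1).Coprime n) : ∏ l ∈ {0}ᶜ, symmSum χ k l = 1 :=
  prod_ne_zero_eq_one hn hχ hk (-k) fun l => by rw [sub_one_mul_symmSum, neg_mul]

/-- If `(2 k + 1) (2 k' + 1) = 1 + 2 n c`, the symmetric geometric sums of these lengths are inverse
to each other at all nontrivial characters. -/
theorem symmSum_mul_symmSum [IsDomain R] {χ : AddChar (ZMod n) R} (hχ : χ.IsPrimitive)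
    {k k' c : ℕ} (h : (2 * k + 1) * (2 * k' + 1) = 1 + 2 * n * c) (l : ZMod n) :
    symmSum χ k l * symmSum χ k' ((2 * k + 1 : ℕ) * l) =
      1 + 2 * c * if l = 0 then (n : R) else 0 := by
  by_cases hl : l = 0
  · subst hl
    have := congrArg (Nat.cast : ℕ → R) h
    push_cast at this
    rw [mul_zero, symmSum_zero, symmSum_zero, this, if_pos rfl]
    ring
  · have hnat : k + k' * (2 * k + 1) = n * c := by linarith
    have hcast : (k : ZMod n) + k' * (2 * k + 1 : ℕ) = 0 := by
      rw [← Nat.cast_mul, ← Nat.cast_add, hnat, Nat.cast_mul, ZMod.natCast_self, zero_mul]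
    have e1 := sub_one_mul_symmSum χ k l
    have e2 := sub_one_mul_symmSum χ k' ((2 * k + 1 : ℕ) * l)
    have hprod : ((2 * k' + 1 : ℕ) : ZMod n) * ((2 * k + 1 : ℕ) * l) = l := by
      rw [← mul_assoc, ← Nat.cast_mul, mul_comm (2 * k' + 1), h]
      simp
    have hphase : χ (-(k * l)) * χ (-(k' * ((2 * k + 1 : ℕ) * l))) = 1 := by
      rw [← AddChar.map_add_eq_mul, ← AddChar.map_zero_eq_one χ]
      congr 1
      linear_combination -l * hcast
    rw [hprod] at e2
    have hne : χ l - 1 ≠ 0 := by rwa [sub_ne_zero, Ne, char_eq_one_iff hχ]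
    rw [if_neg hl, mul_zero, add_zero]
    refine mul_left_cancel₀ hne ?_
    linear_combination symmSum χ k' ((2 * k + 1 : ℕ) * l) * e1 + χ (-(k * l)) * e2 +
      (χ l - 1) * hphase

/-- The square of a symmetric geometric sum is congruent modulo `2` to its image under `t ↦ t ^ 2`,
and the difference is twice a sum of the form `h + h̄ + k`. -/
theorem exists_symmSum_sq_eq (χ : AddChar (ZMod n) R) (k : ℕ) : ∃ H ∈ fourierRing χ, ∀ l,
    symmSum χ k l ^ 2 = symmSum χ k (2 * l) + 2 * (H l + H (-l) + k) := by
  induction k with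
  | zero => exact ⟨0, zero_mem _, fun l => by simp [symmSum]⟩
  | succ k ih =>
    obtain ⟨H, hH, h⟩ := ih
    refine ⟨H + (fun l => symmSum χ k (1 * l)) * fun l => χ ((k + 1 : ℕ) * l),
      add_mem hH (mul_mem (symmSum_mem χ k 1) (char_mem_fourierRing χ _)), fun l => ?_⟩
    have e1 : χ ((k + 1 : ℕ) * (2 * l)) = χ ((k + 1 : ℕ) * l) ^ 2 := by
      rw [sq, ← AddChar.map_add_eq_mul]; congr 1; ring
    have e2 : χ (-((k + 1 : ℕ) * (2 * l))) = χ (-((k + 1 : ℕ) * l)) ^ 2 := by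
      rw [sq, ← AddChar.map_add_eq_mul]; congr 1; ring
    have e3 : χ ((k + 1 : ℕ) * l) * χ (-((k + 1 : ℕ) * l)) = 1 := by
      rw [← AddChar.map_add_eq_mul, add_neg_cancel, AddChar.map_zero_eq_one]
    simp only [Pi.add_apply, Pi.mul_apply, one_mul, symmSum_neg, mul_neg]
    rw [symmSum_succ, symmSum_succ, e1, e2]
    push_cast at e3 ⊢
    linear_combination h l + 2 * e3

/-- The symmetric geometric sum in `t ^ j` has the form `1 + X + X̄`. -/
theorem exists_symmSum_eq (χ : AddChar (ZMod n) R) (k : ℕ) (j : ZMod n) : ∃ X ∈ fourierRing χ,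
    ∀ l, symmSum χ k (j * l) = 1 + (X l + X (-l)) := by
  refine ⟨∑ i ∈ Finset.range k, fun l => χ (((i + 1 : ℕ) * j) * l),
    sum_mem fun i _ => char_mem_fourierRing χ _, fun l => ?_⟩
  simp [symmSum, Finset.sum_apply, ← Finset.sum_add_distrib, mul_assoc]

/-- Every odd number `p` coprime to `n` is a determinant up to sign. With `S` the symmetric
geometric sum of length `p`, the element `U = S(t ^ 2) / S(t)`, made integral and of value `1` at the trivial
character, is a symmetric unit of norm `1`, and `± S = U + 2 (h + h̄)` for a suitable `h`: the
difference `± S - U` is even since `S(t) ^ 2 ≡ S(t ^ 2)` modulo `2`, and its half has even constant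
coefficient when the sign is chosen so that `± p ≡ 1` modulo `4`. -/
theorem exists_natAbs_groupDeterminant_eq (hn : Odd n) {p : ℕ} (hp : p.Coprime (2 * n)) :
    ∃ x : QuaternionGroup n → ℤ, (groupDeterminant x).natAbs = p := by
  have hζ := Complex.isPrimitiveRoot_exp n (NeZero.ne n)
  have hχ := AddChar.zmodChar_primitive_of_primitive_root n hζ
  set χ := AddChar.zmodChar n ((IsPrimitiveRoot.iff_def _ n).mp hζ).left
  have hn2 : 1 < 2 * n := by have := NeZero.pos n; omega
  obtain ⟨k, rfl⟩ : Odd p := Nat.coprime_two_right.1 (Nat.Coprime.coprime_mul_right_right hp)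
  have hpn : (2 * k + 1).Coprime n := Nat.Coprime.coprime_mul_left_right hp
  obtain ⟨r, -, hr⟩ := Nat.exists_mul_mod_eq_one_of_coprime hp hn2
  have hdiv := Nat.mod_add_div ((2 * k + 1) * r) (2 * n)
  rw [hr] at hdiv
  set c := (2 * k + 1) * r / (2 * n)
  obtain ⟨k', rfl⟩ : Odd r := by
    have : Odd ((2 * k + 1) * r) := ⟨n * c, by rw [← hdiv]; ring⟩
    exact (Nat.odd_mul.1 this).2
  have hST := symmSum_mul_symmSum hχ hdiv.symm
  have hrn : (2 * k' + 1).Coprime n := by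
    have : (2 * k' + 1).Coprime (2 * n) := by
      refine Nat.coprime_of_mul_modEq_one (2 * k + 1) ?_
      rw [mul_comm (2 * k' + 1), ← hdiv]
      simp [Nat.ModEq]
    exact Nat.Coprime.coprime_mul_left_right this
  set D : ZMod n → ℂ := fun l => if l = 0 then (n : ℂ) else 0 with hD
  have hDmem : D ∈ fourierRing χ := ite_mem_fourierRing hχ
  have hDneg (l : ZMod n) : D (-l) = D l := by simp [hD]
  set T : ZMod n → ℂ := fun l => symmSum χ k' ((2 * k + 1 : ℕ) * l) with hT
  have hTmem : T ∈ fourierRing χ := symmSum_mem χ k' _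
  have hTneg (l : ZMod n) : T (-l) = T l := by simp only [hT, mul_neg, symmSum_neg]
  have hSD (l : ZMod n) : symmSum χ k l * D l = (2 * k + 1) * D l := by
    by_cases hl : l = 0
    · rw [hl, symmSum_zero]
    · simp [hD, hl]
  set U : ZMod n → ℂ := fun l => symmSum χ k (2 * l) * T l - 2 * c * D l with hU
  have hconst (m : ℤ) : (fun _ => (m : ℂ)) ∈ fourierRing χ := intCast_mem (fourierRing χ) m
  have hUmem : U ∈ fourierRing χ := by
    refine sub_mem (mul_mem (symmSum_mem χ k 2) hTmem) (mul_mem (b := D) ?_ hDmem)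
    simpa using hconst (2 * c)
  have hUneg (l : ZMod n) : U (-l) = U l := by
    simp only [hU, mul_neg, symmSum_neg, hTneg, hDneg]
  have hprodU : ∏ l, U l = 1 := by
    have h0 : U 0 = 1 := by
      have := hST 0
      simp only [hU, hT, hD, mul_zero, if_pos, symmSum_zero] at this ⊢
      linear_combination this
    rw [← Finset.prod_mul_prod_compl {0}, Finset.prod_singleton, h0, one_mul]
    have h1 := prod_symmSum hn hχ hpn
    rw [← prod_unit_mul_compl_zero _ (Nat.coprime_two_left.2 hn)] at h1
    have h2 := prod_symmSum hn hχ hrn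
    rw [← prod_unit_mul_compl_zero _ hpn] at h2
    have h12 := congrArg₂ (· * ·) h1 h2
    simp only [← Finset.prod_mul_distrib, mul_one] at h12
    rw [← h12]
    refine Finset.prod_congr rfl fun l hl => ?_
    have hl0 : l ≠ 0 := by simpa using hl
    simp [hU, hT, hD, hl0]
  have hprodS : ∏ l, symmSum χ k l = 2 * k + 1 := by
    rw [← Finset.prod_mul_prod_compl {0}, Finset.prod_singleton, symmSum_zero,
      prod_symmSum hn hχ hpn, mul_one]
  obtain ⟨H, hH, hsq⟩ := exists_symmSum_sq_eq χ k
  obtain ⟨X, hX, hS2⟩ := exists_symmSum_eq χ k 2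
  obtain ⟨s, hs, h, hh, hUh⟩ : ∃ s : ℤ, (s = 1 ∨ s = -1) ∧ ∃ h ∈ fourierRing χ, ∀ l,
      U l + 2 * (h l + h (-l)) = s * symmSum χ k l := by
    -- the sign makes the integer `k` or `k + 1` in `(± S - U) / 2` even, so that it can be halved
    rcases Nat.even_or_odd' k with ⟨m, hm | hm⟩
    · refine ⟨1, Or.inl rfl, fun l => (H l + (m : ℤ)) * T l - ((2 * m * c : ℤ) : ℂ) * D l,
        sub_mem (mul_mem (add_mem hH (hconst _)) hTmem) (mul_mem (b := D) (hconst _) hDmem),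
        fun l => ?_⟩
      have hkm : (k : ℂ) = 2 * m := by rw [hm]; push_cast; ring
      have e1 := hST l
      have e2 := hSD l
      have e3 := hsq l
      simp only [hU, hTneg, hDneg]
      push_cast
      rw [hkm] at e2 e3
      linear_combination symmSum χ k l * e1 - T l * e3 + 2 * c * e2
    · refine ⟨-1, Or.inr rfl,
        fun l => -((H l + X l + ((m + 1 : ℤ) : ℂ)) * T l) + ((2 * (m + 1) * c : ℤ) : ℂ) * D l,
        add_mem (neg_mem (mul_mem (add_mem (add_mem hH hX) (hconst _)) hTmem))
          (mul_mem (b := D) (hconst _) hDmem), fun l => ?_⟩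
      have hkm : (k : ℂ) = 2 * m + 1 := by rw [hm]; push_cast; ring
      have e1 := hST l
      have e2 := hSD l
      have e3 := hsq l
      have e4 := hS2 l
      simp only [hU, hTneg, hDneg]
      push_cast
      rw [hkm] at e2 e3
      linear_combination -symmSum χ k l * e1 + T l * e3 - 2 * c * e2 + 2 * T l * e4
  obtain ⟨x, hx⟩ := exists_groupDeterminant_eq hn hχ hUmem hh
  refine ⟨x, ?_⟩
  have hx' : ((groupDeterminant x : ℤ) : ℂ) = ((s ^ n * (2 * k + 1) : ℤ) : ℂ) := by
    have hfac (l : ZMod n) : U l * U (-l) + 2 * (U l * h (-l) + U (-l) * h l) =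
        U l * (s * symmSum χ k l) := by
      rw [hUneg, ← hUh]; ring
    rw [hx, Finset.prod_congr rfl fun l _ => hfac l]
    simp only [hUneg, Finset.prod_mul_distrib, hprodU, hprodS, Finset.prod_const,
      Finset.card_univ, ZMod.card]
    push_cast
    ring
  rw [Int.cast_inj.1 hx', Int.natAbs_mul, Int.natAbs_pow]
  have : s.natAbs = 1 := by rcases hs with rfl | rfl <;> rfl
  rw [this, one_pow, one_mul]
  omega

end

/-! ### The smallest nontrivial determinant -/

/-- The smallest prime `p₀` not dividing `2 * n` and the number `16` are determinants. Conversely, a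
determinant `m` with `2 ≤ m < p₀` has a prime factor `q ∣ 2 * n`, and is then divisible by `16` or
by `q ^ 3 ≥ 27`. -/
theorem isLeast_nontrivialAbsDeterminants {n : ℕ} [NeZero n] (hn : Odd n) {p₀ : ℕ}
    (h₀ : IsLeast {p : ℕ | p.Prime ∧ ¬ p ∣ 2 * n} p₀) :
    IsLeast (nontrivialAbsDeterminants (QuaternionGroup n)) (min 16 p₀) := by
  obtain ⟨⟨hp₀, hp₀n⟩, hmin⟩ := h₀
  constructor
  · rcases min_choice 16 p₀ with h | h <;> rw [h]
    · obtain ⟨x, hx⟩ := exists_groupDeterminant_eq_sixteen hn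
      exact ⟨by norm_num, _, ⟨x, rfl⟩, by simp only [hx]; rfl⟩
    · obtain ⟨x, hx⟩ := exists_natAbs_groupDeterminant_eq hn ((hp₀.coprime_iff_not_dvd).2 hp₀n)
      exact ⟨hp₀.two_le, _, ⟨x, rfl⟩, hx⟩
  · rintro m ⟨hm2, _, ⟨x, rfl⟩, rfl⟩
    simp only at hm2 ⊢
    set d := groupDeterminant x
    by_contra! hlt
    obtain ⟨hlt16, hltp⟩ := lt_min_iff.1 hlt
    have hpos : 0 < d.natAbs := by omega
    obtain ⟨q, hq, hqd⟩ := Nat.exists_prime_and_dvd (n := d.natAbs) (by omega)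
    have hqn : q ∣ 2 * n := by
      by_contra h
      have h1 := hmin ⟨hq, h⟩
      have h2 := Nat.le_of_dvd hpos hqd
      omega
    have hqd' : (q : ℤ) ∣ d := Int.natCast_dvd.2 hqd
    by_cases hq2 : q = 2
    · subst hq2
      have h : 16 ≤ d.natAbs :=
        Nat.le_of_dvd hpos (Int.natCast_dvd.1 (sixteen_dvd_groupDeterminant hn x hqd'))
      omega
    · have : Fact q.Prime := ⟨hq⟩
      have hqn' : q ∣ n := (hq.dvd_mul.1 hqn).resolve_left fun h =>
        hq2 ((Nat.prime_dvd_prime_iff_eq hq Nat.prime_two).1 h)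
      have h := prime_pow_three_dvd_groupDeterminant hq2 hqn' x hqd'
      rw [← Nat.cast_pow, Int.natCast_dvd] at h
      have h1 := Nat.le_of_dvd hpos h
      have h2 : 3 ^ 3 ≤ q ^ 3 := Nat.pow_le_pow_left (by have := hq.two_le; omega) 3
      omega

theorem theorem1 (n : ℕ) [NeZero n] (hn : Odd n) :
    IsLeast (nontrivialAbsDeterminants (QuaternionGroup n))
      (minimalDeterminant (QuaternionGroup n)) ∧
    (∃ p₀ : ℕ, IsLeast {p : ℕ | p.Prime ∧ ¬ p ∣ 2 * n} p₀ ∧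
      minimalDeterminant (QuaternionGroup n) = min 16 p₀) ∧
    (¬ 3 ∣ n → minimalDeterminant (QuaternionGroup n) = 3) ∧
    (3 ∣ n → ¬ 5 ∣ n → minimalDeterminant (QuaternionGroup n) = 5) ∧
    (3 * 5 ∣ n → ¬ 7 ∣ n → minimalDeterminant (QuaternionGroup n) = 7) ∧
    (3 * 5 * 7 ∣ n → ¬ 11 ∣ n → minimalDeterminant (QuaternionGroup n) = 11) ∧
    (3 * 5 * 7 * 11 ∣ n → ¬ 13 ∣ n → minimalDeterminant (QuaternionGroup n) = 13) ∧
    (3 * 5 * 7 * 11 * 13 ∣ n → minimalDeterminant (QuaternionGroup n) = 16) := by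
  obtain ⟨p, hp, hpn⟩ : ∃ p : ℕ, p.Prime ∧ ¬ p ∣ 2 * n := by
    obtain ⟨p, hle, hp⟩ := Nat.exists_infinite_primes (2 * n + 1)
    have := NeZero.pos n
    exact ⟨p, hp, fun h => by have := Nat.le_of_dvd (by omega) h; omega⟩
  have hne : {p : ℕ | p.Prime ∧ ¬ p ∣ 2 * n}.Nonempty := ⟨p, hp, hpn⟩
  set p₀ := sInf {p : ℕ | p.Prime ∧ ¬ p ∣ 2 * n}
  have h₀ : IsLeast {p : ℕ | p.Prime ∧ ¬ p ∣ 2 * n} p₀ :=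
    ⟨Nat.sInf_mem hne, fun _ h => Nat.sInf_le h⟩
  have hleast := isLeast_nontrivialAbsDeterminants hn h₀
  have heq : minimalDeterminant (QuaternionGroup n) = min 16 p₀ := hleast.csInf_eq
  have hle (q : ℕ) (hq : q.Prime) (hq2 : q ≠ 2) (hqn : ¬ q ∣ n) : p₀ ≤ q :=
    h₀.2 ⟨hq, fun h => (hq.dvd_mul.1 h).elim
      (fun h => hq2 ((Nat.prime_dvd_prime_iff_eq hq Nat.prime_two).1 h)) hqn⟩
  have hne' (q : ℕ) (hq : q ∣ 2 * n) : p₀ ≠ q := fun h => h₀.1.2 (h ▸ hq)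
  have hprime : p₀.Prime := h₀.1.1
  have h2 := hne' 2 (Dvd.intro _ rfl)
  have htwo := hprime.two_le
  have hcomp (q : ℕ) (hq : ¬ q.Prime) : p₀ ≠ q := fun h => hq (h ▸ hprime)
  have h4 := hcomp 4 (by norm_num)
  have h6 := hcomp 6 (by norm_num)
  have h8 := hcomp 8 (by norm_num)
  have h9 := hcomp 9 (by norm_num)
  have h10 := hcomp 10 (by norm_num)
  have h12 := hcomp 12 (by norm_num)
  have h14 := hcomp 14 (by norm_num)
  have h15 := hcomp 15 (by norm_num)
  have hdvd (q m : ℕ) (hqm : q ∣ m) (hm : m ∣ n) : p₀ ≠ q :=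
    hne' q ((hqm.trans hm).mul_left 2)
  refine ⟨heq ▸ hleast, ⟨p₀, h₀, heq⟩, ?_, ?_, ?_, ?_, ?_, ?_⟩ <;> rw [heq]
  · intro h
    have := hle 3 (by norm_num) (by norm_num) h
    omega
  · intro h h'
    have := hle 5 (by norm_num) (by norm_num) h'
    have := hdvd 3 _ (by norm_num) h
    omega
  · intro h h'
    have := hle 7 (by norm_num) (by norm_num) h'
    have := hdvd 3 _ (by norm_num) h
    have := hdvd 5 _ (by norm_num) h
    omega
  · intro h h'
    have := hle 11 (by norm_num) (by norm_num) h'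
    have := hdvd 3 _ (by norm_num) h
    have := hdvd 5 _ (by norm_num) h
    have := hdvd 7 _ (by norm_num) h
    omega
  · intro h h'
    have := hle 13 (by norm_num) (by norm_num) h'
    have := hdvd 3 _ (by norm_num) h
    have := hdvd 5 _ (by norm_num) h
    have := hdvd 7 _ (by norm_num) h
    have := hdvd 11 _ (by norm_num) h
    omega
  · intro h
    have := hdvd 3 _ (by norm_num) h
    have := hdvd 5 _ (by norm_num) h
    have := hdvd 7 _ (by norm_num) h
    have := hdvd 11 _ (by norm_num) h
    have := hdvd 13 _ (by norm_num) h
    omega
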